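/- Let $\mathbb T\subseteq\mathbb R$ be a time scale (a non-empty closed set), $a,b\in\mathbb T$ with $a<b$, and regard $[a,b]_{\mathbb T}=[a,b]\cap\mathbb T$ as a time scale, with forward jump $\sigma$, graininess $\mu(t)=\sigma(t)-t$ and entrywise delta derivative $X^\Delta$; $[a,b]^\kappa_{\mathbb T}$ is $[a,b]_{\mathbb T}$ without $b$ if $b$ is left-scattered, and is $[a,b]_{\mathbb T}$ otherwise. For real $n\times n$ matrices write $A\le B$ if $z^TAz\le z^TBz$ for all $z\in\mathbb R^n$, and write $P>Q$ if $P-Q$ is symmetric positive definite. Let $S\subseteq\mathbb R^{n\times n}$ and let $F:[a,b]^\kappa_{\mathbb T}\times S\to\mathbb R^{n\times n}$ be right-Hilger-continuous, i.e. $F$ is continuous at $(t,P)$ whenever $t$ is right-dense ($t<b$ and $\sigma(t)=t$), and the limits of $F(s,Y)$ as $(s,Y)\to(t^-,P)$ and of $F(t,Y)$ as $Y\to P$ exist and are finite whenever $t$ is left-dense ($t>a$ and $\rho(t)=t$, where $\rho$ is the backward jump). Let $\mathcal C:[a,b]_{\mathbb T}\to\mathbb R^{n\times n}$ satisfy $z^T\mathcal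 C(t)z>0$ for all $t$ and all $z\ne0$, and suppose that 1. $\mathcal C$ is rd-continuous on $[a,b]_{\mathbb T}$; 2. for every $t\in[a,b]_{\mathbb T}$ the matrix $e_{\mathcal C}(t,a)^{-1}$ commutes with $\mathcal C(t)$ and with every $P\in S$, where $e_{\mathcal C}(t,a)=\exp\left(\int_a^t\xi(s)\,\Delta s\right)$ with $\xi(s)=\mathcal C(s)$ if $\mu(s)=0$ and $\xi(s)=\mu(s)^{-1}\operatorname{Log}(I+\mu(s)\mathcal C(s))$ (principal logarithm) if $\mu(s)>0$. For points $P,Q\in S$ at time $t$ write $P^\Delta=F(t,P)$ and $Q^\Delta=F(t,Q)$ for the derivatives prescribed by the equation. Suppose that any two distinct elements of $S$ are comparable, i.e. one of $P-Q$, $Q-P$ is symmetric positive definite, and that for all $t\in[a,b]^\kappa_{\mathbb T}$ and all $P,Q\in S$ with $P>Q$ the difference is increasing, i.e. $P^\Delta-Q^\Delta\ge0$, and moreover $P^\Delta-Q^\Delta$ is invertible and $$(P-Q)^{-1}\le\mathcal C(t)\,(P^\Delta-Q^\Delta)^{-1}.$$ Then for every $A\in\mathbb R^{n\times n}$ the initial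 value problem $$X^\Delta=F(t,X)\quad(t\in[a,b]^\kappa_{\mathbb T}),\qquad X(a)=A,$$ has at most one solution $X$ on $[a,b]_{\mathbb T}$ with $X(t)\in S$ for all $t\in[a,b]_{\mathbb T}$. -/

import Mathlib

open Set Filter Topology

namespace TimeScale

/-- Forward jump `σ(t) = inf {s ∈ T : s > t}`, with `σ(t) = t` if there is no such `s`. -/
noncomputable def sigma (T : Set ℝ) (t : ℝ) : ℝ :=
  open Classical in if ∃ s ∈ T, t < s then sInf {s | s ∈ T ∧ t < s} else t

/-- Backward jump `ρ(t) = sup {s ∈ T : s < t}`, with `ρ(t) = t` if there is no such `s`. -/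
noncomputable def rho (T : Set ℝ) (t : ℝ) : ℝ :=
  open Classical in if ∃ s ∈ T, s < t then sSup {s | s ∈ T ∧ s < t} else t

/-- Graininess `μ(t) = σ(t) - t`. -/
noncomputable def mu (T : Set ℝ) (t : ℝ) : ℝ := sigma T t - t

/-- `t` is right-dense: it is not the maximum of `T`, and `σ(t) = t`. -/
def RightDense (T : Set ℝ) (t : ℝ) : Prop := (∃ s ∈ T, t < s) ∧ sigma T t = t

/-- `t` is left-dense: it is not the minimum of `T`, and `ρ(t) = t`. -/
def LeftDense (T : Set ℝ) (t : ℝ) : Prop := (∃ s ∈ T, s < t) ∧ rho T t = t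

/-- `T^κ`: the time scale without its left-scattered maximum, if it has one. -/
def kappa (T : Set ℝ) : Set ℝ := {t | t ∈ T ∧ ¬ (IsGreatest T t ∧ rho T t < t)}

/-- The time scale interval `[a,b]_T`, itself regarded as a time scale. -/
def interval (T : Set ℝ) (a b : ℝ) : Set ℝ := Icc a b ∩ T

/-- `d` is the delta derivative of the scalar function `x` at `t`. -/
def HasDeltaDeriv (T : Set ℝ) (x : ℝ → ℝ) (t d : ℝ) : Prop :=
  ∀ ε > 0, ∃ δ > 0, ∀ s ∈ T, |s - t| < δ →
    |(x (sigma T t) - x s) - d * (sigma T t - s)| ≤ ε * |sigma T t - s|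

/-- `D` is the (entrywise) delta derivative of the matrix function `X` at `t`. -/
def HasMatrixDeltaDeriv {n : ℕ} (T : Set ℝ) (X : ℝ → Matrix (Fin n) (Fin n) ℝ) (t : ℝ)
    (D : Matrix (Fin n) (Fin n) ℝ) : Prop :=
  ∀ i j, HasDeltaDeriv T (fun s => X s i j) t (D i j)

/-- `K ∈ C_rd(T)`: continuous at right-dense points, with finite left limits at left-dense points. -/
def RdContinuous {n : ℕ} (T : Set ℝ) (K : ℝ → Matrix (Fin n) (Fin n) ℝ) : Prop :=
  ∀ t ∈ T, (RightDense T t → ContinuousWithinAt K T t) ∧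
    (LeftDense T t → ∃ L, Tendsto K (𝓝[T ∩ Iio t] t) (𝓝 L))

/-- `F : T^κ × S → ℝ^{n×n}` is right-Hilger-continuous. -/
def RightHilgerContinuous {n : ℕ} (T : Set ℝ) (S : Set (Matrix (Fin n) (Fin n) ℝ))
    (F : ℝ → Matrix (Fin n) (Fin n) ℝ → Matrix (Fin n) (Fin n) ℝ) : Prop :=
  ∀ t ∈ kappa T, ∀ P ∈ S,
    (RightDense T t →
      ContinuousWithinAt (fun p : ℝ × Matrix (Fin n) (Fin n) ℝ => F p.1 p.2)
        (kappa T ×ˢ S) (t, P)) ∧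
    (LeftDense T t →
      (∃ L, Tendsto (fun p : ℝ × Matrix (Fin n) (Fin n) ℝ => F p.1 p.2)
        (𝓝[(kappa T ∩ Iio t) ×ˢ S] (t, P)) (𝓝 L)) ∧
      (∃ L, Tendsto (F t) (𝓝[S \ {P}] P) (𝓝 L)))

/-- `zᵀ A z > 0` for all `z ≠ 0` (no symmetry is required). -/
def MatPos {n : ℕ} (A : Matrix (Fin n) (Fin n) ℝ) : Prop :=
  ∀ z : Fin n → ℝ, z ≠ 0 → 0 < z ⬝ᵥ A.mulVec z

/-- `A ≤ B`, i.e. `zᵀ (B - A) z ≥ 0` for all `z` (no symmetry is required). -/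
def MatLE {n : ℕ} (A B : Matrix (Fin n) (Fin n) ℝ) : Prop :=
  ∀ z : Fin n → ℝ, 0 ≤ z ⬝ᵥ (B - A).mulVec z

/-- `G` is an antiderivative of `f`. At the maximum of `T` only continuity is required, since an
rd-continuous `f` may have a jump there; `G` is still determined up to a constant. -/
def IsAntiderivative {n : ℕ} (T : Set ℝ) (G f : ℝ → Matrix (Fin n) (Fin n) ℝ) : Prop :=
  ContinuousOn G T ∧ ∀ t ∈ T, (∃ s ∈ T, t < s) → HasMatrixDeltaDeriv T G t (f t)

/-- The (Cauchy) delta integral `∫_a^t f(s) Δs = G(t) - G(a)`, `G` an antiderivative of `f`. -/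
noncomputable def deltaIntegral {n : ℕ} (T : Set ℝ) (f : ℝ → Matrix (Fin n) (Fin n) ℝ)
    (a t : ℝ) : Matrix (Fin n) (Fin n) ℝ :=
  open Classical in
  if h : ∃ G, IsAntiderivative T G f then h.choose t - h.choose a else 0

/-- `L` is the principal logarithm of `A`: `exp L = A`, and all complex eigenvalues of `L` have
imaginary part in `(-π, π)`. -/
def IsPrincipalLog {n : ℕ} (A L : Matrix (Fin n) (Fin n) ℝ) : Prop :=
  NormedSpace.exp L = A ∧
    ∀ z ∈ spectrum ℂ (L.map (fun x : ℝ => (x : ℂ))), |z.im| < Real.pi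

/-- The principal logarithm `Log A` (which exists and is unique if `A` has no eigenvalue in
`(-∞, 0]`). -/
noncomputable def principalLog {n : ℕ} (A : Matrix (Fin n) (Fin n) ℝ) :
    Matrix (Fin n) (Fin n) ℝ :=
  open Classical in if h : ∃ L, IsPrincipalLog A L then h.choose else 0

/-- The integrand of the exponential: `K(s)` where `μ(s) = 0`, and `Log (I + μ(s) K(s)) / μ(s)`
where `μ(s) > 0`. -/
noncomputable def cylinder {n : ℕ} (T : Set ℝ) (K : ℝ → Matrix (Fin n) (Fin n) ℝ) (s : ℝ) :
    Matrix (Fin n) (Fin n) ℝ :=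
  open Classical in
  if mu T s = 0 then K s else (mu T s)⁻¹ • principalLog (1 + mu T s • K s)

/-- The matrix exponential function `e_K(t, a)` of the time scale `T`. -/
noncomputable def matrixExp {n : ℕ} (T : Set ℝ) (K : ℝ → Matrix (Fin n) (Fin n) ℝ)
    (t a : ℝ) : Matrix (Fin n) (Fin n) ℝ :=
  NormedSpace.exp (deltaIntegral T (cylinder T K) a t)

/-- `X` solves `X^Δ = F(t, X)` on `T^κ` and `X(a) = A`. -/
def IsSolution {n : ℕ} (T : Set ℝ)
    (F : ℝ → Matrix (Fin n) (Fin n) ℝ → Matrix (Fin n) (Fin n) ℝ) (a : ℝ)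
    (A : Matrix (Fin n) (Fin n) ℝ) (X : ℝ → Matrix (Fin n) (Fin n) ℝ) : Prop :=
  X a = A ∧ ∀ t ∈ kappa T, HasMatrixDeltaDeriv T X t (F t (X t))

end TimeScale

/-! Everything reduces to the scalar `w = tr (X - Y)`. Any two points of `S` are comparable, so `X t
- Y t` is zero or plus or minus a positive definite matrix, and `w t = 0` forces `X t = Y t`. For `W
= P - Q` positive definite and `D = F t P - F t Q`, test the hypothesis `W⁻¹ ≤ C D⁻¹` on the column
`x = D eₖ`: the right side becomes `xᵀ C eₖ`, while `|x|² ≤ tr W · xᵀ W⁻¹ x`. Cauchy–Schwarz then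
gives `|x| ≤ tr W · |C eₖ|`, and summing the diagonal entries of `D` yields `|tr D| ≤ n √M tr W`
(`abs_trace_le_of_inv_matLE`), where `M` bounds the squared entries of the rd-continuous `C`. Hence
`|w^Δ| ≤ K |w|` with `w a = 0`, and a Gronwall argument (`eq_zero_of_abs_deltaDeriv_le`) gives `w =
0`. -/

open Asymptotics

namespace TimeScale

/-! ### Jump operators and one-sided neighbourhoods -/

section Jumps

variable {T : Set ℝ} {t : ℝ}

lemma sigma_eq_sInf (h : ∃ s ∈ T, t < s) : sigma T t = sInf {s | s ∈ T ∧ t < s} := if_pos h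

lemma sigma_le {s : ℝ} (hs : s ∈ T) (hts : t < s) : sigma T t ≤ s := by
  rw [sigma_eq_sInf ⟨s, hs, hts⟩]
  exact csInf_le ⟨t, fun _ hx => hx.2.le⟩ ⟨hs, hts⟩

lemma le_sigma (T : Set ℝ) (t : ℝ) : t ≤ sigma T t := by
  by_cases h : ∃ s ∈ T, t < s
  · rw [sigma_eq_sInf h]
    exact le_csInf h fun _ hx => hx.2.le
  · exact (if_neg h).ge

lemma rho_eq_sSup (h : ∃ s ∈ T, s < t) : rho T t = sSup {s | s ∈ T ∧ s < t} := if_pos h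

lemma le_rho {s : ℝ} (hs : s ∈ T) (hst : s < t) : s ≤ rho T t := by
  rw [rho_eq_sSup ⟨s, hs, hst⟩]
  exact le_csSup ⟨t, fun _ hx => hx.2.le⟩ ⟨hs, hst⟩

lemma rho_le (T : Set ℝ) (t : ℝ) : rho T t ≤ t := by
  by_cases h : ∃ s ∈ T, s < t
  · rw [rho_eq_sSup h]
    exact csSup_le h fun _ hx => hx.2.le
  · exact (if_neg h).le

lemma mem_kappa_of_lt {s : ℝ} (ht : t ∈ T) (hs : s ∈ T) (hts : t < s) : t ∈ kappa T :=
  ⟨ht, fun h => (h.1.2 hs).not_gt hts⟩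

lemma LeftDense.mem_kappa (ht : t ∈ T) (h : LeftDense T t) : t ∈ kappa T :=
  ⟨ht, fun h' => h'.2.ne h.2⟩

lemma nhdsWithin_Iio_eq_bot_of_not_leftDense (h : ¬ LeftDense T t) :
    𝓝[T ∩ Iio t] t = ⊥ := by
  by_cases h' : ∃ s ∈ T, s < t
  · have hlt : rho T t < t := lt_of_le_of_ne (rho_le T t) fun e => h ⟨h', e⟩
    rw [← empty_mem_iff_bot, mem_nhdsWithin]
    exact ⟨Ioi (rho T t), isOpen_Ioi, hlt, fun s hs => hs.1.not_ge (le_rho hs.2.1 hs.2.2)⟩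
  · have : T ∩ Iio t = ∅ := eq_empty_of_forall_notMem fun s hs => h' ⟨s, hs.1, hs.2⟩
    rw [this, nhdsWithin_empty]

lemma nhdsWithin_Ioi_eq_bot_of_not_rightDense (h : ¬ RightDense T t) :
    𝓝[T ∩ Ioi t] t = ⊥ := by
  by_cases h' : ∃ s ∈ T, t < s
  · have hlt : t < sigma T t := lt_of_le_of_ne (le_sigma T t) fun e => h ⟨h', e.symm⟩
    rw [← empty_mem_iff_bot, mem_nhdsWithin]
    exact ⟨Iio (sigma T t), isOpen_Iio, hlt, fun s hs => hs.1.not_ge (sigma_le hs.2.1 hs.2.2)⟩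
  · have : T ∩ Ioi t = ∅ := eq_empty_of_forall_notMem fun s hs => h' ⟨s, hs.1, hs.2⟩
    rw [this, nhdsWithin_empty]

lemma nhdsWithin_eq_sup_of_mem (ht : t ∈ T) :
    𝓝[T] t = 𝓝[T ∩ Iio t] t ⊔ pure t ⊔ 𝓝[T ∩ Ioi t] t := by
  rw [← nhdsWithin_singleton, ← nhdsWithin_union, ← nhdsWithin_union]
  congr 1
  ext s
  rcases lt_trichotomy s t with h | rfl | h
  · simp [h, h.ne, h.not_gt]
  · simp [ht]
  · simp [h, h.ne', h.not_gt]

end Jumps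

/-- An rd-continuous matrix function on a compact time scale is bounded. -/
lemma RdContinuous.exists_sum_sq_le {n : ℕ} {T : Set ℝ} (hT : IsCompact T)
    {K : ℝ → Matrix (Fin n) (Fin n) ℝ} (hK : RdContinuous T K) :
    ∃ M, ∀ t ∈ T, ∑ i, ∑ j, K t i j ^ 2 ≤ M := by
  have hcont : Continuous fun B : Matrix (Fin n) (Fin n) ℝ => ∑ i, ∑ j, B i j ^ 2 := by
    fun_prop
  have hbdd : ∀ {l : Filter ℝ} {L : Matrix (Fin n) (Fin n) ℝ}, Tendsto K l (𝓝 L) →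
      ∃ M, ∀ᶠ s in l, ∑ i, ∑ j, K s i j ^ 2 ≤ M := fun {l L} h =>
    ⟨_, (((hcont.tendsto L).comp h).eventually_lt_const (lt_add_one _)).mono fun _ h => h.le⟩
  -- Compactness reduces the claim to local boundedness; near `t` the left side, the right side and
  -- `t` itself are bounded separately.
  refine hT.induction_on (p := fun s => ∃ M, ∀ t ∈ s, ∑ i, ∑ j, K t i j ^ 2 ≤ M) ⟨0, by simp⟩
    (fun s u hsu ⟨M, hM⟩ => ⟨M, fun t ht => hM t (hsu ht)⟩)
    (fun s u ⟨M, hM⟩ ⟨N, hN⟩ => ⟨max M N, ?_⟩) fun t ht => ?_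
  · rintro t (ht | ht)
    · exact (hM t ht).trans (le_max_left _ _)
    · exact (hN t ht).trans (le_max_right _ _)
  · obtain ⟨M₁, h₁⟩ : ∃ M, ∀ᶠ s in 𝓝[T ∩ Iio t] t, ∑ i, ∑ j, K s i j ^ 2 ≤ M := by
      by_cases h : LeftDense T t
      · exact hbdd ((hK t ht).2 h).choose_spec
      · rw [nhdsWithin_Iio_eq_bot_of_not_leftDense h]
        exact ⟨0, eventually_bot⟩
    obtain ⟨M₂, h₂⟩ : ∃ M, ∀ᶠ s in 𝓝[T ∩ Ioi t] t, ∑ i, ∑ j, K s i j ^ 2 ≤ M := by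
      by_cases h : RightDense T t
      · exact hbdd (((hK t ht).1 h).mono_left (nhdsWithin_mono t inter_subset_left))
      · rw [nhdsWithin_Ioi_eq_bot_of_not_rightDense h]
        exact ⟨0, eventually_bot⟩
    refine ⟨{s | ∑ i, ∑ j, K s i j ^ 2 ≤ max (max M₁ M₂) (∑ i, ∑ j, K t i j ^ 2)}, ?_,
      _, fun _ hs => hs⟩
    rw [nhdsWithin_eq_sup_of_mem ht, mem_sup, mem_sup]
    refine ⟨⟨h₁.mono fun s hs => hs.trans ?_, ?_⟩, h₂.mono fun s hs => hs.trans ?_⟩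
    · exact (le_max_left _ _).trans (le_max_left _ _)
    · exact le_max_right (max M₁ M₂) _
    · exact (le_max_right _ _).trans (le_max_left _ _)

/-! ### Delta derivatives as little-o estimates -/

section DeltaDeriv

variable {T : Set ℝ} {x y : ℝ → ℝ} {t d e : ℝ}

lemma hasDeltaDeriv_iff_isLittleO : HasDeltaDeriv T x t d ↔
    (fun s => (x (sigma T t) - x s) - d * (sigma T t - s)) =o[𝓝[T] t]
      fun s => sigma T t - s := by
  rw [isLittleO_iff]
  refine forall₂_congr fun ε _ => ?_
  rw [eventually_nhdsWithin_iff, Metric.eventually_nhds_iff]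
  simp only [Real.dist_eq, Real.norm_eq_abs]
  exact exists_congr fun δ => and_congr_right fun _ =>
    ⟨fun h s h₁ h₂ => h s h₂ h₁, fun h s h₁ h₂ => h h₂ h₁⟩

lemma HasDeltaDeriv.sub (hx : HasDeltaDeriv T x t d) (hy : HasDeltaDeriv T y t e) :
    HasDeltaDeriv T (fun s => x s - y s) t (d - e) := by
  rw [hasDeltaDeriv_iff_isLittleO] at *
  exact (hx.sub hy).congr_left fun s => by ring

lemma HasDeltaDeriv.sum {ι : Type*} {u : Finset ι} {f : ι → ℝ → ℝ} {f' : ι → ℝ}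
    (h : ∀ i ∈ u, HasDeltaDeriv T (f i) t (f' i)) :
    HasDeltaDeriv T (fun s => ∑ i ∈ u, f i s) t (∑ i ∈ u, f' i) := by
  simp only [hasDeltaDeriv_iff_isLittleO] at *
  refine (IsLittleO.sum h).congr_left fun s => ?_
  rw [Finset.sum_apply, Finset.sum_mul, ← Finset.sum_sub_distrib, ← Finset.sum_sub_distrib]

lemma HasMatrixDeltaDeriv.trace_sub {n : ℕ} {X Y : ℝ → Matrix (Fin n) (Fin n) ℝ}
    {D E : Matrix (Fin n) (Fin n) ℝ} (hX : HasMatrixDeltaDeriv T X t D)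
    (hY : HasMatrixDeltaDeriv T Y t E) :
    HasDeltaDeriv T (fun s => (X s - Y s).trace) t (D - E).trace :=
  HasDeltaDeriv.sum fun i _ => (hX i i).sub (hY i i)

/-- At `s = t` the defining estimate holds for every `ε`, so the error there is exactly zero. -/
lemma HasDeltaDeriv.apply_sigma (ht : t ∈ T) (h : HasDeltaDeriv T x t d) :
    x (sigma T t) = x t + d * (sigma T t - t) := by
  have h0 := (isLittleO_pure.1 ((hasDeltaDeriv_iff_isLittleO.1 h).mono (pure_le_nhdsWithin ht)))
  linarith

lemma HasDeltaDeriv.continuousWithinAt (ht : t ∈ T) (h : HasDeltaDeriv T x t d) :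
    ContinuousWithinAt x T t := by
  have hlin : Tendsto (fun s => sigma T t - s) (𝓝[T] t) (𝓝 (sigma T t - t)) :=
    (continuous_const.sub continuous_id).continuousWithinAt
  have h0 := (isLittleO_one_iff ℝ).1
    ((hasDeltaDeriv_iff_isLittleO.1 h).trans_isBigO (hlin.isBigO_one ℝ))
  have hlim := ((hlin.const_mul d).const_sub (x (sigma T t))).sub h0
  rw [sub_zero, h.apply_sigma ht, add_sub_cancel_right] at hlim
  exact hlim.congr fun s => by ring

end DeltaDeriv

/-! ### Gronwall's inequality -/

/-- The points of a closed time scale below `t` accumulate at `t`, or `t` is the successor of its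
predecessor. -/
lemma leftDense_or_exists_sigma_eq {T : Set ℝ} (hT : IsClosed T) {t : ℝ} (ht : t ∈ T)
    (h : ∃ s ∈ T, s < t) : LeftDense T t ∨ ∃ u ∈ T, u < t ∧ sigma T u = t := by
  rcases (rho_le T t).eq_or_lt with e | hlt
  · exact .inl ⟨h, e⟩
  · have hu : rho T t ∈ T := by
      rw [rho_eq_sSup h]
      exact closure_minimal (fun _ hs => hs.1) hT
        (csSup_mem_closure (s := {s | s ∈ T ∧ s < t}) h ⟨t, fun _ hs => hs.2.le⟩)
    refine .inr ⟨_, hu, hlt, (sigma_le ht hlt).antisymm ?_⟩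
    rw [sigma_eq_sInf ⟨t, ht, hlt⟩]
    refine le_csInf ⟨t, ht, hlt⟩ fun s hs => ?_
    by_contra! hst
    exact hs.2.not_ge (le_rho hs.1 hst)

/-- A Gronwall-type bound on a compact time scale. -/
lemma abs_le_mul_exp_of_abs_deltaDeriv_le {T : Set ℝ} (hT : IsClosed T) {a : ℝ}
    (haT : IsLeast T a) {w w' : ℝ → ℝ} {K ε : ℝ} (hK : 0 ≤ K) (hε : 0 < ε)
    (hw : ∀ t ∈ kappa T, HasDeltaDeriv T w t (w' t)) (hw' : ∀ t ∈ kappa T, |w' t| ≤ K * |w t|)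
    (h0 : w a = 0) {t : ℝ} (ht : t ∈ T) : |w t| ≤ ε * Real.exp ((K + 1) * (t - a)) := by
  -- The exponent has `K + 1` rather than `K`: the spare `1` absorbs the error of the derivative at
  -- a right-dense point.
  set g : ℝ → ℝ := fun s => ε * Real.exp ((K + 1) * (s - a)) with hg
  have hgpos : ∀ s, 0 < g s := fun s => by positivity
  have hgcont : Continuous g := by fun_prop
  have hgstep : ∀ c s, g c * (1 + (K + 1) * (s - c)) ≤ g s := fun c s => by
    have h1 := Real.add_one_le_exp ((K + 1) * (s - c))
    have h2 : g s = g c * Real.exp ((K + 1) * (s - c)) := by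
      simp only [hg]
      rw [mul_assoc, ← Real.exp_add]
      ring_nf
    rw [h2]
    exact mul_le_mul_of_nonneg_left (by linarith) (hgpos c).le
  by_contra! hbad
  set B : Set ℝ := {s | s ∈ T ∧ g s < |w s|}
  have hBne : B.Nonempty := ⟨t, ht, hbad⟩
  have hBbdd : BddBelow B := ⟨a, fun s hs => haT.2 hs.1⟩
  set c := sInf B
  have hcT : c ∈ T := closure_minimal (fun _ hs => hs.1) hT (csInf_mem_closure hBne hBbdd)
  have hlt : ∀ s ∈ T, s < c → |w s| ≤ g s := fun s hs hsc => by
    by_contra! h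
    exact (csInf_le hBbdd ⟨hs, h⟩).not_gt hsc
  -- If the bound already fails at the infimum `c`, the contradiction comes from the left, by
  -- continuity or by one jump; otherwise failures accumulate at `c` from the right.
  by_cases hcB : c ∈ B
  · have hac : a < c := by
      refine lt_of_le_of_ne (haT.2 hcT) ?_
      rintro e
      have := hcB.2
      rw [← e, h0, abs_zero] at this
      exact this.not_gt (hgpos a)
    rcases leftDense_or_exists_sigma_eq hT hcT ⟨a, haT.1, hac⟩ with hld | ⟨u, huT, huc, hσ⟩
    · have hcont := (hw c (hld.mem_kappa hcT)).continuousWithinAt hcT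
      have hev : ∀ᶠ s in 𝓝[T] c, g s < |w s| :=
        hgcont.continuousWithinAt.tendsto.eventually_lt hcont.abs hcB.2
      obtain ⟨δ, hδ, h⟩ := Metric.eventually_nhds_iff.1 (eventually_nhdsWithin_iff.1 hev)
      obtain ⟨s, ⟨hsT, hsc⟩, hs⟩ : ∃ s ∈ {s | s ∈ T ∧ s < c}, c - δ < s := by
        refine exists_lt_of_lt_csSup hld.1 ?_
        rw [← rho_eq_sSup hld.1, hld.2]
        linarith
      refine (h ?_ hsT).not_ge (hlt s hsT hsc)
      rw [Real.dist_eq, abs_lt]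
      constructor <;> linarith
    · have huκ := mem_kappa_of_lt huT hcT huc
      have h1 := (hw u huκ).apply_sigma huT
      rw [hσ] at h1
      refine hcB.2.not_ge ?_
      calc |w c| ≤ |w u| + |w' u| * (c - u) := by
            rw [h1]
            refine (abs_add_le _ _).trans ?_
            rw [abs_mul, abs_of_pos (sub_pos.2 huc)]
        _ ≤ |w u| + K * |w u| * (c - u) := by
            have := sub_pos.2 huc
            gcongr
            exact hw' u huκ
        _ = |w u| * (1 + K * (c - u)) := by ring
        _ ≤ g u * (1 + (K + 1) * (c - u)) := by
            have := sub_pos.2 huc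
            gcongr
            · exact hlt u huT huc
            · linarith
        _ ≤ g c := hgstep u c
  · have hcgood : |w c| ≤ g c := by
      by_contra! h
      exact hcB ⟨hcT, h⟩
    have hnear : ∀ δ > 0, ∃ s ∈ B, c < s ∧ s < c + δ := fun δ hδ => by
      obtain ⟨s, hs, hsδ⟩ := exists_lt_of_csInf_lt hBne (show sInf B < c + δ by linarith)
      exact ⟨s, hs, lt_of_le_of_ne (csInf_le hBbdd hs) fun e => hcB (e ▸ hs), hsδ⟩
    obtain ⟨s₀, hs₀, hcs₀, -⟩ := hnear 1 one_pos
    have hcκ := mem_kappa_of_lt hcT hs₀.1 hcs₀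
    have hσ : sigma T c = c := by
      refine le_antisymm (le_of_forall_pos_le_add fun δ hδ => ?_) (le_sigma T c)
      obtain ⟨s, hs, hcs, hsδ⟩ := hnear δ hδ
      exact (sigma_le hs.1 hcs).trans hsδ.le
    -- The tolerance `g c` makes the error at most `g c * (s - c)`, exactly the spare term.
    obtain ⟨δ, hδ, h⟩ := hw c hcκ (g c) (hgpos c)
    obtain ⟨s, hs, hcs, hsδ⟩ := hnear δ hδ
    have hpos := sub_pos.2 hcs
    have h1 := h s hs.1 (by rw [abs_of_pos hpos]; linarith)
    rw [hσ, abs_sub_comm c s, abs_of_pos hpos] at h1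
    refine hs.2.not_ge ?_
    calc |w s| = |w c + w' c * (s - c) + -(w c - w s - w' c * (c - s))| := by ring_nf
      _ ≤ |w c| + |w' c| * (s - c) + g c * (s - c) := by
          refine (abs_add_le _ _).trans (add_le_add ((abs_add_le _ _).trans ?_) ?_)
          · rw [abs_mul, abs_of_pos hpos]
          · rwa [abs_neg]
      _ ≤ g c + K * g c * (s - c) + g c * (s - c) := by
          gcongr
          exact (hw' c hcκ).trans (by gcongr)
      _ = g c * (1 + (K + 1) * (s - c)) := by ring
      _ ≤ g s := hgstep c s

/-- The Gronwall bound holds for every `ε > 0`; let `ε` tend to `0`. -/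
lemma eq_zero_of_abs_deltaDeriv_le {T : Set ℝ} (hT : IsClosed T) {a : ℝ}
    (haT : IsLeast T a) {w w' : ℝ → ℝ} {K : ℝ} (hK : 0 ≤ K)
    (hw : ∀ t ∈ kappa T, HasDeltaDeriv T w t (w' t)) (hw' : ∀ t ∈ kappa T, |w' t| ≤ K * |w t|)
    (h0 : w a = 0) {t : ℝ} (ht : t ∈ T) : w t = 0 := by
  refine abs_nonpos_iff.1 (le_of_forall_pos_le_add fun η hη => ?_)
  have h := abs_le_mul_exp_of_abs_deltaDeriv_le hT haT hK
    (div_pos hη (Real.exp_pos ((K + 1) * (t - a)))) hw hw' h0 ht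
  rwa [div_mul_cancel₀ _ (Real.exp_ne_zero _), ← zero_add η] at h

/-! ### Trace estimates for positive definite matrices -/

section MatrixBounds

variable {n : ℕ}

open scoped MatrixOrder Matrix.Norms.L2Operator in
/-- For positive semidefinite `W`, `|W y|² ≤ tr W · yᵀ W y`. -/
lemma dotProduct_mulVec_self_le {W : Matrix (Fin n) (Fin n) ℝ} (hW : W.PosSemidef)
    (y : Fin n → ℝ) : W.mulVec y ⬝ᵥ W.mulVec y ≤ W.trace * (y ⬝ᵥ W.mulVec y) := by
  obtain ⟨B, rfl⟩ := CStarAlgebra.nonneg_iff_eq_star_mul_self.mp hW.nonneg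
  have hform : ∀ u v : Fin n → ℝ, u ⬝ᵥ (star B * B).mulVec v = B.mulVec u ⬝ᵥ B.mulVec v :=
    fun u v => by
      rw [← Matrix.mulVec_mulVec, Matrix.star_eq_conjTranspose,
        Matrix.conjTranspose_eq_transpose_of_trivial, Matrix.dotProduct_mulVec,
        Matrix.vecMul_transpose]
  -- With `W = BᵀB`, the entry `(W y)ᵢ` is the inner product of `B eᵢ` and `B y`, so Cauchy–Schwarz
  -- applies.
  have hentry : ∀ i, ((star B * B).mulVec y i) ^ 2 ≤
      (star B * B) i i * (y ⬝ᵥ (star B * B).mulVec y) := fun i => by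
    have h1 : (star B * B).mulVec y i = B.mulVec (Pi.single i 1) ⬝ᵥ B.mulVec y := by
      rw [← hform, single_one_dotProduct]
    have h2 : (star B * B) i i = B.mulVec (Pi.single i 1) ⬝ᵥ B.mulVec (Pi.single i 1) := by
      rw [← hform, single_one_dotProduct]
      simp
    rw [h1, h2, hform]
    simp only [dotProduct, ← sq]
    exact Finset.sum_mul_sq_le_sq_mul_sq _ _ _
  rw [Matrix.trace, Finset.sum_mul]
  simp only [dotProduct, ← sq, Matrix.diag] at hentry ⊢
  exact Finset.sum_le_sum fun i _ => hentry i

lemma dotProduct_self_le_trace_mul {W : Matrix (Fin n) (Fin n) ℝ} (hW : W.PosDef)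
    (x : Fin n → ℝ) : x ⬝ᵥ x ≤ W.trace * (x ⬝ᵥ W⁻¹.mulVec x) := by
  have hx : W.mulVec (W⁻¹.mulVec x) = x := by
    rw [Matrix.mulVec_mulVec, Matrix.mul_nonsing_inv _ ((Matrix.isUnit_iff_isUnit_det _).1 hW.isUnit),
      Matrix.one_mulVec]
  have h := dotProduct_mulVec_self_le hW.posSemidef (W⁻¹.mulVec x)
  rwa [hx, dotProduct_comm (W⁻¹.mulVec x)] at h

/-- Testing on columns of `D` cancels `D⁻¹`, leaving a column of `C`. -/
lemma abs_trace_le_of_inv_matLE {W D C : Matrix (Fin n) (Fin n) ℝ} {M : ℝ} (hW : W.PosDef)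
    (hD : IsUnit D) (h : MatLE W⁻¹ (C * D⁻¹)) (hM : ∑ i, ∑ j, C i j ^ 2 ≤ M) :
    |D.trace| ≤ n * √M * W.trace := by
  have hW0 : 0 ≤ W.trace := hW.posSemidef.trace_nonneg
  have hdiag : ∀ k, |D k k| ≤ √M * W.trace := fun k => by
    set x := D.mulVec (Pi.single k 1) with hx
    have hxi : ∀ i, x i = D i k := fun i => by simp [hx]
    have hCx : (C * D⁻¹).mulVec x = fun i => C i k := by
      rw [hx, Matrix.mulVec_mulVec, mul_assoc,
        Matrix.nonsing_inv_mul _ ((Matrix.isUnit_iff_isUnit_det _).1 hD), mul_one]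
      ext i
      simp
    have h1 : x ⬝ᵥ x ≤ W.trace * (x ⬝ᵥ fun i => C i k) := by
      refine (dotProduct_self_le_trace_mul hW x).trans (mul_le_mul_of_nonneg_left ?_ hW0)
      have := h x
      rw [Matrix.sub_mulVec, hCx, dotProduct_sub] at this
      linarith
    have hCS : (x ⬝ᵥ fun i => C i k) ^ 2 ≤ (x ⬝ᵥ x) * M := by
      refine (Finset.sum_mul_sq_le_sq_mul_sq _ _ _).trans ?_
      have h2 : ∑ i, C i k ^ 2 ≤ M := le_trans (Finset.sum_le_sum fun i _ =>
        Finset.single_le_sum (f := fun j => C i j ^ 2) (fun j _ => sq_nonneg _)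
          (Finset.mem_univ k)) hM
      simp only [dotProduct, ← sq]
      exact mul_le_mul_of_nonneg_left h2 (Finset.sum_nonneg fun i _ => sq_nonneg _)
    have hq : D k k ^ 2 ≤ x ⬝ᵥ x := by
      rw [← hxi k, sq]
      exact Finset.single_le_sum (f := fun i => x i * x i) (fun i _ => mul_self_nonneg _)
        (Finset.mem_univ k)
    have hM0 : 0 ≤ M := le_trans (by positivity) hM
    have hq' : x ⬝ᵥ x ≤ W.trace ^ 2 * M := by
      have hq0 : 0 ≤ x ⬝ᵥ x := (sq_nonneg _).trans hq
      -- The goal follows by cancelling one factor `x ⬝ᵥ x`, which must be nonzero.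
      rcases hq0.eq_or_lt with e | hq0
      · rw [← e]; positivity
      · refine le_of_mul_le_mul_left ?_ hq0
        calc (x ⬝ᵥ x) * (x ⬝ᵥ x) ≤ (W.trace * (x ⬝ᵥ fun i => C i k)) ^ 2 := by
              rw [sq]
              exact mul_self_le_mul_self hq0.le h1
          _ = W.trace ^ 2 * (x ⬝ᵥ fun i => C i k) ^ 2 := mul_pow _ _ _
          _ ≤ W.trace ^ 2 * ((x ⬝ᵥ x) * M) := by gcongr
          _ = _ := by ring
    refine abs_le_of_sq_le_sq ?_ (by positivity)
    rw [mul_pow, Real.sq_sqrt hM0]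
    linarith
  calc |D.trace| ≤ ∑ k, |D k k| := Finset.abs_sum_le_sum_abs _ _
    _ ≤ ∑ _k : Fin n, √M * W.trace := Finset.sum_le_sum fun k _ => hdiag k
    _ = n * √M * W.trace := by simp [mul_assoc]

end MatrixBounds

end TimeScale

/-! ### Uniqueness of the solution -/

set_option linter.unusedVariables false in
theorem mainTheorem9 {n : ℕ} (T : Set ℝ) (hT : IsClosed T) (a b : ℝ) (ha : a ∈ T) (hb : b ∈ T)
    (hab : a < b)
    (S : Set (Matrix (Fin n) (Fin n) ℝ))
    (F : ℝ → Matrix (Fin n) (Fin n) ℝ → Matrix (Fin n) (Fin n) ℝ)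
    (hF : TimeScale.RightHilgerContinuous (TimeScale.interval T a b) S F)
    (C : ℝ → Matrix (Fin n) (Fin n) ℝ)
    (hCpos : ∀ t ∈ TimeScale.interval T a b, TimeScale.MatPos (C t))
    (hCrd : TimeScale.RdContinuous (TimeScale.interval T a b) C)
    (hcommC : ∀ t ∈ TimeScale.interval T a b,
      Commute (TimeScale.matrixExp (TimeScale.interval T a b) C t a)⁻¹ (C t))
    (hcommS : ∀ t ∈ TimeScale.interval T a b, ∀ P ∈ S,
      Commute (TimeScale.matrixExp (TimeScale.interval T a b) C t a)⁻¹ P)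
    (hpos : ∀ P ∈ S, ∀ Q ∈ S, P ≠ Q → (P - Q).PosDef ∨ (Q - P).PosDef)
    (hincr : ∀ t ∈ TimeScale.kappa (TimeScale.interval T a b), ∀ P ∈ S, ∀ Q ∈ S,
      (P - Q).PosDef → TimeScale.MatLE 0 (F t P - F t Q))
    (hLip : ∀ t ∈ TimeScale.kappa (TimeScale.interval T a b), ∀ P ∈ S, ∀ Q ∈ S,
      (P - Q).PosDef → IsUnit (F t P - F t Q) ∧
        TimeScale.MatLE (P - Q)⁻¹ (C t * (F t P - F t Q)⁻¹))
    (A : Matrix (Fin n) (Fin n) ℝ) (X Y : ℝ → Matrix (Fin n) (Fin n) ℝ)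
    (hX : TimeScale.IsSolution (TimeScale.interval T a b) F a A X)
    (hY : TimeScale.IsSolution (TimeScale.interval T a b) F a A Y)
    (hXS : ∀ t ∈ TimeScale.interval T a b, X t ∈ S)
    (hYS : ∀ t ∈ TimeScale.interval T a b, Y t ∈ S) :
    ∀ t ∈ TimeScale.interval T a b, X t = Y t := by
  have hI : IsCompact (TimeScale.interval T a b) := isCompact_Icc.inter_right hT
  have haI : IsLeast (TimeScale.interval T a b) a :=
    ⟨⟨left_mem_Icc.2 hab.le, ha⟩, fun _ hs => hs.1.1⟩
  obtain ⟨M, hM⟩ := hCrd.exists_sum_sq_le hI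
  have hbound : ∀ t ∈ TimeScale.kappa (TimeScale.interval T a b), ∀ P ∈ S, ∀ Q ∈ S,
      (P - Q).PosDef → |(F t P - F t Q).trace| ≤ n * √M * |(P - Q).trace| :=
    fun t ht P hP Q hQ h => by
      obtain ⟨hu, hle⟩ := hLip t ht P hP Q hQ h
      rw [abs_of_nonneg h.posSemidef.trace_nonneg]
      exact TimeScale.abs_trace_le_of_inv_matLE h hu hle (hM t ht.1)
  have htrace : ∀ t ∈ TimeScale.interval T a b, (X t - Y t).trace = 0 := fun t ht => by
    refine TimeScale.eq_zero_of_abs_deltaDeriv_le hI.isClosed haI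
      (w := fun t => (X t - Y t).trace) (w' := fun t => (F t (X t) - F t (Y t)).trace)
      (K := n * √M) (by positivity)
      (fun t ht => (hX.2 t ht).trace_sub (hY.2 t ht)) (fun t ht => ?_) ?_ ht
    · by_cases he : X t = Y t
      · simp [he]
      · rcases hpos _ (hXS t ht.1) _ (hYS t ht.1) he with h | h
        · exact hbound t ht _ (hXS t ht.1) _ (hYS t ht.1) h
        · have := hbound t ht _ (hYS t ht.1) _ (hXS t ht.1) h
          rwa [← neg_sub, Matrix.trace_neg, abs_neg, ← neg_sub (X t), Matrix.trace_neg,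
            abs_neg] at this
    · simp [hX.1, hY.1]
  intro t ht
  by_contra he
  -- A positive definite matrix has positive trace only when `n > 0`; for `n = 0` all matrices
  -- coincide.
  have : Nonempty (Fin n) := by
    by_contra hn
    rw [not_nonempty_iff] at hn
    exact he (Subsingleton.elim _ _)
  have h0 := htrace t ht
  rcases hpos _ (hXS t ht) _ (hYS t ht) he with h | h
  · exact h.trace_pos.ne' h0
  · refine h.trace_pos.ne' ?_
    rw [← neg_sub, Matrix.trace_neg, h0, neg_zero]
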